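/- Let $k$ be a field and let $A=\bigoplus_{i\ge 0}A_i$ be a connected ($A_0=k$), locally finite-dimensional ($\dim_k A_i<\infty$ for all $i$), left noetherian graded $k$-algebra that is Artin--Schelter regular of dimension $d$: $\operatorname{gl.dim}(A)=d<\infty$, $\operatorname{Ext}_A^i(k,A)=0$ for $i\neq d$ and $\operatorname{Ext}_A^d(k,A)\cong k$ (no condition on the Gelfand--Kirillov dimension is needed). Let $f\in A_+=\bigoplus_{i>0}A_i$ be a homogeneous element that is normal ($Af=fA$) and regular (neither a left nor a right zero divisor), and let $B=A/(f)$. Let $M$ be a nonzero finitely generated $\mathbb{Z}$-graded left $B$-module and let $\cdots\to P_2\to P_1\to P_0\to M\to 0$ be a resolution of $M$ by graded projective left $B$-modules, with maps of degree $0$. Put $\Omega_0(M)=M$ and $\Omega_j(M)=\operatorname{im}(P_j\to P_{j-1})$ for $j\ge 1$. Then there is an $i$ with $0\le i\le d$ such that $\Omega_i(M)$, regarded as an $A$-module, has projective dimension exactly $1$: $\operatorname{pd}_A(\Omega_i(M))=1$. -/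

import Mathlib

universe u

open CategoryTheory

noncomputable section

namespace NCHypersurface

/-! ### Connected graded algebras and Artin-Schelter regularity -/

section Algebra

variable {k A : Type u} [Field k] [Ring A] [Algebra k A]

/-- The `ℕ`-graded `k`-algebra `A = ⨁ 𝒜 i` is connected, `𝒜 0 = k`, and locally
finite-dimensional, `dim_k 𝒜 i < ∞` for all `i`. -/
structure IsConnectedLocallyFinite (𝒜 : ℕ → Submodule k A) : Prop where
  nontrivial : Nontrivial A
  zero_eq : 𝒜 0 = LinearMap.range (Algebra.linearMap k A)
  finiteDimensional : ∀ i, Module.Finite k (𝒜 i)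

/-- The trivial left `A`-module `k = A / A₊`, where `A₊ = ⨁_{i > 0} 𝒜 i`. -/
def trivialModule (𝒜 : ℕ → Submodule k A) [GradedAlgebra 𝒜] : ModuleCat.{u} A :=
  ModuleCat.of A (A ⧸ (HomogeneousIdeal.irrelevant 𝒜).toIdeal)

variable (A) in
/-- The left global dimension: the supremum of the projective dimensions of left modules. -/
def globalDimension : WithBot ℕ∞ :=
  ⨆ X : ModuleCat.{u} A, projectiveDimension X

/-- Artin-Schelter regularity of dimension `d` of a connected graded algebra: `gl.dim A = d`,
and `Ext_A^i(k, A)` is `0` for `i ≠ d` and is one-dimensional over `k` for `i = d`.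
(Being a graded right `A`-module, a one-dimensional `Ext_A^d(k, A)` is the trivial module
up to a shift.)  Nothing is required of the Gelfand-Kirillov dimension, so that this class
contains the algebras for which one asks `GKdim A = d` in addition. -/
structure IsArtinSchelterRegular (𝒜 : ℕ → Submodule k A) [GradedAlgebra 𝒜] (d : ℕ) : Prop where
  isConnected : IsConnectedLocallyFinite 𝒜
  globalDimension_eq : globalDimension A = d
  ext_eq_zero : ∀ i, i ≠ d →
    Subsingleton (Abelian.Ext.{u} (trivialModule 𝒜) (ModuleCat.of A A) i)
  finrank_ext : Module.finrank k (Abelian.Ext.{u} (trivialModule 𝒜) (ModuleCat.of A A) d) = 1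

/-- An element `f` is normal if `A f = f A`. -/
def IsNormalElement (f : A) : Prop :=
  (Set.range fun a : A => a * f) = Set.range fun a : A => f * a

end Algebra

/-! ### Graded modules and graded projective resolutions -/

section Modules

variable {R : Type u} [Ring R]

/-- A `ℤ`-graded left module over a ring `R` graded by the subgroups `𝓡 i`, `i ∈ ℕ`. -/
structure GrMod (𝓡 : ℕ → AddSubgroup R) where
  carrier : Type u
  [addCommGroup : AddCommGroup carrier]
  [module : Module R carrier]
  grading : ℤ → AddSubgroup carrier
  isInternal : DirectSum.IsInternal grading
  smul_mem : ∀ (i : ℕ) (j : ℤ) (r : R) (m : carrier),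
    r ∈ 𝓡 i → m ∈ grading j → r • m ∈ grading (i + j)

attribute [instance] GrMod.addCommGroup GrMod.module

variable {𝓡 : ℕ → AddSubgroup R}

/-- A linear map between graded modules is a morphism of graded modules if it is homogeneous
of degree `0`. -/
def IsGradedHom {M N : GrMod 𝓡} (φ : M.carrier →ₗ[R] N.carrier) : Prop :=
  ∀ i, ∀ m ∈ M.grading i, φ m ∈ N.grading i

/-- `P` is a projective object among graded modules with morphisms of degree `0`. -/
def IsGradedProjective (P : GrMod 𝓡) : Prop :=
  ∀ (N L : GrMod 𝓡) (g : N.carrier →ₗ[R] L.carrier) (h : P.carrier →ₗ[R] L.carrier),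
    IsGradedHom g → Function.Surjective g → IsGradedHom h →
      ∃ h' : P.carrier →ₗ[R] N.carrier, IsGradedHom h' ∧ g ∘ₗ h' = h

/-- A graded projective resolution `⋯ → P₂ → P₁ → P₀ → M → 0` of a graded module `M`. -/
structure GradedProjectiveResolution (M : GrMod 𝓡) where
  P : ℕ → GrMod 𝓡
  ε : (P 0).carrier →ₗ[R] M.carrier
  δ : ∀ n, (P (n + 1)).carrier →ₗ[R] (P n).carrier
  isGradedProjective : ∀ n, IsGradedProjective (P n)
  isGradedHom_ε : IsGradedHom ε
  isGradedHom_δ : ∀ n, IsGradedHom (δ n)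
  surjective_ε : Function.Surjective ε
  exact_zero : Function.Exact (δ 0) ε
  exact_succ : ∀ n, Function.Exact (δ (n + 1)) (δ n)

/-- The syzygies of a resolution: `Ω₀(M) = M` and `Ωⱼ(M) = im (Pⱼ → Pⱼ₋₁)` for `j ≥ 1`. -/
def GradedProjectiveResolution.syzygy {M : GrMod 𝓡} (P : GradedProjectiveResolution M) :
    ℕ → ModuleCat.{u} R
  | 0 => ModuleCat.of R M.carrier
  | j + 1 => ModuleCat.of R (LinearMap.range (P.δ j))

end Modules

/-! ### The quotient `B = A / (f)` -/

section Quotient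

variable {k A : Type u} [Field k] [Ring A] [Algebra k A]

/-- The ring `A / (f)`, where `(f)` is the two-sided ideal generated by `f`. -/
abbrev QuotientBy (f : A) : Type u :=
  (TwoSidedIdeal.span {f}).ringCon.Quotient

/-- The projection `A → A / (f)`. -/
def proj (f : A) : A →+* QuotientBy f :=
  (TwoSidedIdeal.span {f}).ringCon.mk'

/-- The grading of `A / (f)` induced by the grading of `A`. -/
def quotientGrading (𝒜 : ℕ → Submodule k A) (f : A) : ℕ → AddSubgroup (QuotientBy f) :=
  fun i => (𝒜 i).toAddSubgroup.map (proj f).toAddMonoidHom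

/-- The projective dimension over `A` of an `A / (f)`-module. -/
def pdOver {f : A} (N : ModuleCat.{u} (QuotientBy f)) : WithBot ℕ∞ :=
  projectiveDimension ((ModuleCat.restrictScalars.{u} (proj f)).obj N)

end Quotient

end NCHypersurface

end

/-! Exactness of 0 → A → A → B → 0, with right multiplication by f as first map, gives free
B-modules, and hence their summands, projective dimension at most 1 over A
(`hasProjectiveDimensionLT_two_of_projective`). Graded projectives are projective
(`IsGradedProjective.projective`), so along 0 → Ωₙ₊₁ → Pₙ → Ωₙ → 0 dimension shifting lowers the
projective dimension over A by one until it is at most 1. Since gl.dim A = d, step d is late enough.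

Conversely, a nonzero B-module is never projective over A: f kills it but acts injectively on free
A-modules (`subsingleton_of_hasProjectiveDimensionLT_one`). So Ω_d works if it is nonzero; otherwise
the last nonzero syzygy is isomorphic to its Pₙ and works instead. -/

namespace NCHypersurface

/-! ### Gradings from families of projections -/

section Gradings

/-- A family of additive projections onto subgroups which are pairwise orthogonal and span. -/
structure GradingProjections {ι M : Type*} [AddCommGroup M] (G : ι → AddSubgroup M) where
  proj : ι → M →+ M
  proj_of_mem : ∀ i, ∀ x ∈ G i, proj i x = x
  proj_of_mem_ne : ∀ i j, i ≠ j → ∀ x ∈ G i, proj j x = 0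
  iSup_eq_top : ⨆ i, G i = ⊤

/-- The j-th projection recovers the j-th component from a sum, which gives injectivity. -/
theorem GradingProjections.isInternal {ι M : Type*} [DecidableEq ι] [AddCommGroup M]
    {G : ι → AddSubgroup M} (p : GradingProjections G) : DirectSum.IsInternal G := by
  have key : ∀ (j : ι) (x : DirectSum ι fun i => G i),
      p.proj j (DirectSum.coeAddMonoidHom G x) = x j := by
    intro j x
    induction x using DirectSum.induction_on with
    | zero => simp
    | of i x =>
      rw [DirectSum.coeAddMonoidHom_of]
      by_cases h : i = j
      · subst h
        rw [p.proj_of_mem i x x.2, DirectSum.of_eq_same]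
      · rw [p.proj_of_mem_ne i j h x x.2, DirectSum.of_eq_of_ne _ _ _ (Ne.symm h)]
        rfl
    | add x y hx hy => simp [hx, hy]
  refine ⟨(injective_iff_map_eq_zero _).2 fun x hx => ?_, fun x => ?_⟩
  · refine DFinsupp.ext fun j => Subtype.ext ?_
    have h := key j x
    rw [hx, map_zero] at h
    exact h.symm
  · have hx : x ∈ ⨆ i, G i := p.iSup_eq_top ▸ AddSubgroup.mem_top x
    rw [← AddMonoidHom.mem_range]
    refine (iSup_le fun i y hy => ?_ : ⨆ i, G i ≤ (DirectSum.coeAddMonoidHom G).range) hx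
    exact ⟨DirectSum.of (fun i => G i) i ⟨y, hy⟩, DirectSum.coeAddMonoidHom_of _ _ _⟩

variable {R : Type*} [Ring R]

/-- Extension by zero of a family of subgroups indexed by `ℕ` to one indexed by `ℤ`. -/
def extendGrading (𝓡 : ℕ → AddSubgroup R) : ℤ → AddSubgroup R
  | .ofNat n => 𝓡 n
  | .negSucc _ => ⊥

/-- Projections for a grading by `ℕ` give projections for its extension by zero to `ℤ`. -/
def GradingProjections.extend {𝓡 : ℕ → AddSubgroup R} (p : GradingProjections 𝓡) :
    GradingProjections (extendGrading 𝓡) where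
  proj
    | .ofNat n => p.proj n
    | .negSucc _ => 0
  proj_of_mem i x hx := by
    cases i with
    | ofNat n => exact p.proj_of_mem n x hx
    | negSucc n => exact ((AddSubgroup.mem_bot).1 hx).symm
  proj_of_mem_ne i j hij x hx := by
    cases i with
    | ofNat n =>
      cases j with
      | ofNat m => exact p.proj_of_mem_ne n m (fun h => hij (by rw [h])) x hx
      | negSucc m => rfl
    | negSucc n => rw [(AddSubgroup.mem_bot).1 hx, map_zero]
  iSup_eq_top := by
    rw [eq_top_iff, ← p.iSup_eq_top]
    exact iSup_le fun n => le_iSup (extendGrading 𝓡) (n : ℤ)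

theorem mul_mem_extendGrading {𝓡 : ℕ → AddSubgroup R}
    (hmul : ∀ i j, ∀ a ∈ 𝓡 i, ∀ b ∈ 𝓡 j, a * b ∈ 𝓡 (i + j)) (i : ℕ) (j : ℤ) {a b : R}
    (ha : a ∈ 𝓡 i) (hb : b ∈ extendGrading 𝓡 j) : a * b ∈ extendGrading 𝓡 (i + j) := by
  cases j with
  | ofNat n => exact hmul i n a ha b hb
  | negSucc n =>
    rw [(AddSubgroup.mem_bot).1 hb, mul_zero]
    exact zero_mem _

/-- The grading of a free module with basis elements in the degrees `deg`. -/
def freeGrading {ι : Type*} (𝓡 : ℕ → AddSubgroup R) (deg : ι → ℤ) (n : ℤ) :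
    AddSubgroup (ι →₀ R) where
  carrier := {x | ∀ s, x s ∈ extendGrading 𝓡 (n - deg s)}
  zero_mem' _ := zero_mem _
  add_mem' hx hy s := add_mem (hx s) (hy s)
  neg_mem' hx s := neg_mem (hx s)

/-- The projections onto the homogeneous components of a graded free module. -/
noncomputable def GradingProjections.free {ι : Type*} {𝓡 : ℕ → AddSubgroup R} (p : GradingProjections 𝓡)
    (deg : ι → ℤ) : GradingProjections (freeGrading 𝓡 deg) where
  proj n :=
    { toFun := fun x => Finsupp.onFinset x.support (fun s => p.extend.proj (n - deg s) (x s))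
        fun s hs => by
          rw [Finsupp.mem_support_iff]
          rintro h
          exact hs (by rw [h, map_zero])
      map_zero' := by ext; simp
      map_add' := fun x y => by ext; simp }
  proj_of_mem n x hx := by
    ext s
    exact p.extend.proj_of_mem _ _ (hx s)
  proj_of_mem_ne n m hnm x hx := by
    ext s
    exact p.extend.proj_of_mem_ne _ _ (fun h => hnm (by linarith)) _ (hx s)
  iSup_eq_top := by
    rw [eq_top_iff]
    rintro x -
    induction x using Finsupp.induction_linear with
    | zero => exact zero_mem _
    | add x y hx hy => exact add_mem hx hy
    | single s b =>
      have h : (⨆ i, 𝓡 i) ≤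
          (⨆ n, freeGrading 𝓡 deg n).comap (Finsupp.singleAddHom s) := by
        refine iSup_le fun i b hb => ?_
        refine le_iSup (freeGrading 𝓡 deg) (i + deg s) (show Finsupp.single s b ∈ _ from ?_)
        intro t
        by_cases hst : s = t
        · subst hst
          rw [Finsupp.single_eq_same, add_sub_cancel_right]
          exact hb
        · rw [Finsupp.single_eq_of_ne (Ne.symm hst)]
          exact zero_mem _
      exact h (p.iSup_eq_top ▸ AddSubgroup.mem_top b)

end Gradings

/-! ### Graded projective modules are projective -/

section GradedProjective

universe v

variable {R : Type v} [Ring R] {𝓡 : ℕ → AddSubgroup R}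

/-- The graded free module with basis elements in the degrees `deg`. -/
noncomputable def gradedFree (p : GradingProjections 𝓡)
    (hmul : ∀ i j, ∀ a ∈ 𝓡 i, ∀ b ∈ 𝓡 j, a * b ∈ 𝓡 (i + j)) {ι : Type v} (deg : ι → ℤ) :
    GrMod 𝓡 where
  carrier := ι →₀ R
  grading := freeGrading 𝓡 deg
  isInternal := (p.free deg).isInternal
  smul_mem i j r x hr hx s := by
    rw [Finsupp.smul_apply, smul_eq_mul, add_sub_assoc]
    exact mul_mem_extendGrading hmul i _ hr (hx s)

/-- The free module on all homogeneous elements of P, with each basis vector in the degree of its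
element, covers P in degree 0. Lifting the identity splits the cover, so P is a summand of a free
module once gradings are forgotten. -/
theorem IsGradedProjective.projective (p : GradingProjections 𝓡)
    (hmul : ∀ i j, ∀ a ∈ 𝓡 i, ∀ b ∈ 𝓡 j, a * b ∈ 𝓡 (i + j)) {P : GrMod 𝓡}
    (hP : IsGradedProjective P) : Module.Projective R P.carrier := by
  let ι := Σ j : ℤ, P.grading j
  let F : GrMod 𝓡 := gradedFree p hmul (fun s : ι => s.1)
  let g : (ι →₀ R) →ₗ[R] P.carrier := Finsupp.linearCombination R fun s : ι => (s.2 : P.carrier)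
  have hg : IsGradedHom (M := F) (N := P) g := by
    intro n (x : ι →₀ R) hx
    change Finsupp.linearCombination R (fun s : ι => (s.2 : P.carrier)) x ∈ _
    rw [Finsupp.linearCombination_apply]
    refine sum_mem fun s _ => ?_
    have hs : x s ∈ extendGrading 𝓡 (n - s.1) := hx s
    obtain ⟨m, hm⟩ : ∃ m, m = n - s.1 := ⟨_, rfl⟩
    rw [← hm] at hs
    cases m with
    | ofNat m =>
      have h := P.smul_mem m s.1 (x s) s.2 hs s.2.2
      have e : (m : ℤ) + s.1 = n := by
        have : (m : ℤ) = n - s.1 := hm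
        linarith
      rwa [e] at h
    | negSucc m =>
      simp only [(AddSubgroup.mem_bot).1 hs, zero_smul]
      exact zero_mem _
  have hsurj : Function.Surjective g := by
    intro y
    obtain ⟨z, rfl⟩ := P.isInternal.2 y
    induction z using DirectSum.induction_on with
    | zero => exact ⟨0, by simp⟩
    | of i z =>
      refine ⟨Finsupp.single ⟨i, z⟩ 1, ?_⟩
      rw [DirectSum.coeAddMonoidHom_of, Finsupp.linearCombination_single, one_smul]
    | add a b ha hb =>
      obtain ⟨u, hu⟩ := ha
      obtain ⟨v, hv⟩ := hb
      exact ⟨u + v, by rw [map_add, map_add, hu, hv]⟩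
  obtain ⟨h, -, hh⟩ := hP F P g LinearMap.id hg hsurj fun _ _ hm => hm
  let h' : P.carrier →ₗ[R] (ι →₀ R) := h
  exact Module.Projective.of_split h' g hh

end GradedProjective

/-! ### The quotient by a normal element -/

section Quotient

variable {k A : Type u} [Field k] [Ring A] [Algebra k A]

theorem proj_surjective (f : A) : Function.Surjective (proj f) :=
  RingCon.mk'_surjective _

theorem proj_eq_zero_iff_mem_span {f a : A} :
    proj f a = 0 ↔ a ∈ TwoSidedIdeal.span {f} := by
  rw [TwoSidedIdeal.mem_iff]
  exact RingCon.eq _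

theorem proj_self (f : A) : proj f f = 0 :=
  proj_eq_zero_iff_mem_span.2 (TwoSidedIdeal.subset_span rfl)

/-- Normality makes the right ideal fA two-sided, so it already contains the ideal generated by f.
-/
theorem IsNormalElement.exists_eq_mul_right {f : A} (hf : IsNormalElement f) {a : A}
    (ha : proj f a = 0) : ∃ b, a = f * b := by
  rw [proj_eq_zero_iff_mem_span] at ha
  induction ha using TwoSidedIdeal.span_induction with
  | mem x hx => exact ⟨1, by rw [mul_one]; exact hx⟩
  | zero => exact ⟨0, (mul_zero f).symm⟩
  | add x y _ _ hx hy =>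
    obtain ⟨b, rfl⟩ := hx
    obtain ⟨c, rfl⟩ := hy
    exact ⟨b + c, (mul_add f b c).symm⟩
  | neg x _ hx =>
    obtain ⟨b, rfl⟩ := hx
    exact ⟨-b, (mul_neg f b).symm⟩
  | left_absorb a x _ hx =>
    obtain ⟨b, rfl⟩ := hx
    obtain ⟨c, hc⟩ : a * f ∈ Set.range fun a : A => f * a := hf ▸ ⟨a, rfl⟩
    refine ⟨c * b, ?_⟩
    rw [← mul_assoc, ← mul_assoc]
    exact congrArg (· * b) hc.symm
  | right_absorb c x _ hx =>
    obtain ⟨b, rfl⟩ := hx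
    exact ⟨b * c, mul_assoc f b c⟩

theorem IsNormalElement.proj_eq_zero_iff {f : A} (hf : IsNormalElement f) {a : A} :
    proj f a = 0 ↔ ∃ b, b * f = a := by
  constructor
  · intro ha
    obtain ⟨b, rfl⟩ := hf.exists_eq_mul_right ha
    have : f * b ∈ Set.range fun a : A => a * f := hf.symm ▸ ⟨b, rfl⟩
    exact this
  · rintro ⟨b, rfl⟩
    rw [map_mul, proj_self, mul_zero]

variable (𝒜 : ℕ → Submodule k A) [GradedAlgebra 𝒜]

theorem mul_mem_quotientGrading (f : A) (i j : ℕ) :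
    ∀ a ∈ quotientGrading 𝒜 f i, ∀ b ∈ quotientGrading 𝒜 f j,
      a * b ∈ quotientGrading 𝒜 f (i + j) := by
  rintro _ ⟨a, ha, rfl⟩ _ ⟨b, hb, rfl⟩
  exact ⟨a * b, SetLike.mul_mem_graded (A := 𝒜) ha hb, map_mul (proj f) a b⟩

/-- As f is homogeneous, each component of f * b is zero or f times a component of b; hence the
component maps descend to A / (f). -/
theorem proj_component_eq_zero {f : A} {e : ℕ} (hfe : f ∈ 𝒜 e) (hf : IsNormalElement f)
    (j : ℕ) {a : A} (ha : proj f a = 0) : proj f (GradedRing.proj 𝒜 j a) = 0 := by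
  obtain ⟨b, rfl⟩ := hf.exists_eq_mul_right ha
  rw [GradedRing.proj_apply, DirectSum.coe_decompose_mul_of_left_mem 𝒜 j hfe]
  split_ifs
  · rw [map_mul, proj_self, zero_mul]
  · exact map_zero _

/-- The projections onto the homogeneous components of `A / (f)`. -/
noncomputable def quotientProjections {f : A} {e : ℕ} (hfe : f ∈ 𝒜 e) (hf : IsNormalElement f) :
    GradingProjections (quotientGrading 𝒜 f) :=
  let π : A →+ QuotientBy f := (proj f).toAddMonoidHom
  let P (j : ℕ) : QuotientBy f →+ QuotientBy f :=
    π.liftOfSurjective (proj_surjective f) ⟨π.comp (GradedRing.proj 𝒜 j),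
      fun _ ha => proj_component_eq_zero 𝒜 hfe hf j ha⟩
  have hP (j : ℕ) (a : A) : P j (proj f a) = proj f (GradedRing.proj 𝒜 j a) :=
    AddMonoidHom.liftOfRightInverse_comp_apply π _ _ _ a
  { proj := P
    proj_of_mem := by
      rintro i _ ⟨a, ha, rfl⟩
      refine (hP i a).trans (congrArg (proj f) ?_)
      exact DirectSum.decompose_of_mem_same 𝒜 ha
    proj_of_mem_ne := by
      rintro i j hij _ ⟨a, ha, rfl⟩
      refine (hP j a).trans ?_
      rw [GradedRing.proj_apply, DirectSum.decompose_of_mem_ne 𝒜 ha hij, map_zero]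
    iSup_eq_top := by
      rw [eq_top_iff]
      rintro x -
      obtain ⟨a, rfl⟩ := proj_surjective f x
      induction a using DirectSum.Decomposition.inductionOn 𝒜 with
      | zero => rw [map_zero]; exact zero_mem _
      | @homogeneous i a => exact le_iSup (quotientGrading 𝒜 f) i ⟨a, a.2, rfl⟩
      | add a b ha hb => rw [map_add]; exact add_mem ha hb }

/-! ### Projective dimensions over `A` -/

theorem restrictScalars_map_shortExact {R S : Type u} [Ring R] [Ring S] (φ : R →+* S)
    {T : ShortComplex (ModuleCat.{u} S)} (hT : T.ShortExact) :
    (T.map (ModuleCat.restrictScalars.{u} φ)).ShortExact :=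
  ModuleCat.shortComplex_shortExact _
    ((ShortComplex.ShortExact.moduleCat_exact_iff_function_exact T).1 hT.exact)
    hT.moduleCat_injective_f hT.moduleCat_surjective_g

theorem hasProjectiveDimensionLT_two_finsupp {f : A} (hf : IsNormalElement f)
    (hreg : IsRegular f) (ι : Type u) :
    HasProjectiveDimensionLT ((ModuleCat.restrictScalars.{u} (proj f)).obj
      (ModuleCat.of (QuotientBy f) (ι →₀ QuotientBy f))) 2 := by
  let X := (ModuleCat.restrictScalars.{u} (proj f)).obj
      (ModuleCat.of (QuotientBy f) (ι →₀ QuotientBy f))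
  let r : (ι →₀ A) →ₗ[A] (ι →₀ A) :=
    Finsupp.mapRange.linearMap (LinearMap.toSpanSingleton A A f)
  let q : (ι →₀ A) →ₗ[A] X :=
    { toFun := fun x => (Finsupp.mapRange (proj f) (map_zero _) x : ι →₀ QuotientBy f)
      map_add' := fun x y => Finsupp.mapRange_add (map_add _) x y
      map_smul' := fun a x => by
        refine Finsupp.ext fun s => ?_
        exact map_mul (proj f) a (x s) }
  have hr (x : ι →₀ A) (s : ι) : r x s = x s * f := rfl
  have hq (x : ι →₀ A) (s : ι) : (show ι →₀ QuotientBy f from q x) s = proj f (x s) := rfl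
  have hrq (x : ι →₀ A) : q x = 0 ↔ ∃ y, r y = x := by
    constructor
    · intro hx
      have h (s : ι) : ∃ b, b * f = x s := hf.proj_eq_zero_iff.1 <| by
        rw [← hq, hx]; rfl
      choose b hb using h
      refine ⟨Finsupp.onFinset x.support b fun s hs => ?_, Finsupp.ext hb⟩
      rw [Finsupp.mem_support_iff, ← hb]
      -- Regularity forces the chosen quotient to vanish wherever x does, so the quotients have
      -- finite support.
      exact fun h => hs (hreg.right (h.trans (zero_mul f).symm))
    · rintro ⟨y, rfl⟩
      refine Finsupp.ext fun s => ?_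
      exact (hq _ s).trans (hf.proj_eq_zero_iff.2 ⟨y s, rfl⟩)
  have hS : (ModuleCat.shortComplexOfCompEqZero r q
      (LinearMap.ext fun y => (hrq _).2 ⟨y, rfl⟩)).ShortExact := by
    refine ModuleCat.shortComplex_shortExact _ hrq (fun x y hxy => ?_) fun x => ?_
    · refine Finsupp.ext fun s => hreg.right ?_
      exact DFunLike.congr_fun (F := ι →₀ A) hxy s
    · exact Finsupp.mapRange_surjective _ (map_zero _) (proj_surjective f) x
  have : Projective (ModuleCat.of A (ι →₀ A)) :=
    (IsProjective.iff_projective _).1 inferInstance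
  exact hS.hasProjectiveDimensionLT_X₃ 1 (inferInstanceAs
    (HasProjectiveDimensionLT (ModuleCat.of A (ι →₀ A)) 1)) (inferInstanceAs
    (HasProjectiveDimensionLT (ModuleCat.of A (ι →₀ A)) (1 + 1)))

theorem hasProjectiveDimensionLT_two_of_projective {f : A} (hf : IsNormalElement f)
    (hreg : IsRegular f) (P : Type u) [AddCommGroup P] [Module (QuotientBy f) P]
    [Module.Projective (QuotientBy f) P] :
    HasProjectiveDimensionLT ((ModuleCat.restrictScalars.{u} (proj f)).obj
      (ModuleCat.of (QuotientBy f) P)) 2 := by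
  obtain ⟨s, hs⟩ := (Module.projective_def' (R := QuotientBy f) (P := P)).1 inferInstance
  let ρ : Retract (ModuleCat.of (QuotientBy f) P)
      (ModuleCat.of (QuotientBy f) (P →₀ QuotientBy f)) :=
    { i := ModuleCat.ofHom s
      r := ModuleCat.ofHom (Finsupp.linearCombination (QuotientBy f) id)
      retract := by rw [← ModuleCat.ofHom_comp, hs]; rfl }
  have := hasProjectiveDimensionLT_two_finsupp hf hreg P
  exact (ρ.map (ModuleCat.restrictScalars.{u} (proj f))).hasProjectiveDimensionLT 2

/-- A splitting s embeds a projective module in a free one, where f * s(x) = s(f • x) = 0 forces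
s(x) = 0. -/
theorem subsingleton_of_hasProjectiveDimensionLT_one {f : A} (hreg : IsRegular f)
    (N : ModuleCat.{u} (QuotientBy f))
    (hN : HasProjectiveDimensionLT ((ModuleCat.restrictScalars.{u} (proj f)).obj N) 1) :
    Subsingleton N := by
  let X := (ModuleCat.restrictScalars.{u} (proj f)).obj N
  have h : Projective X := inferInstance
  have : Module.Projective A X := (IsProjective.iff_projective X).2 h
  obtain ⟨s, hs⟩ := (Module.projective_def' (R := A) (P := X)).1 inferInstance
  have hzero (x : X) : x = 0 := by
    have hfx : f • x = 0 := by
      refine (ModuleCat.restrictScalars.smul_def (proj f) f x).trans ?_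
      rw [proj_self]
      exact zero_smul _ _
    have hsx : s x = 0 := by
      refine Finsupp.ext fun t => hreg.left ?_
      have := DFunLike.congr_fun (map_smul s f x) t
      rw [hfx, map_zero] at this
      exact this.symm.trans (mul_zero f).symm
    have := LinearMap.congr_fun hs x
    rw [LinearMap.comp_apply, hsx, map_zero] at this
    exact this.symm
  exact ⟨fun x y => (hzero x).trans (hzero y).symm⟩

theorem pdOver_eq_one {f : A} (hreg : IsRegular f) (N : ModuleCat.{u} (QuotientBy f))
    [Nontrivial N]
    (hN : HasProjectiveDimensionLT ((ModuleCat.restrictScalars.{u} (proj f)).obj N) 2) :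
    pdOver N = 1 := by
  refine le_antisymm ((projectiveDimension_le_iff _ 1).2 hN)
    ((projectiveDimension_ge_iff _ 1).2 fun h => ?_)
  exact not_subsingleton N (subsingleton_of_hasProjectiveDimensionLT_one hreg N h)

theorem hasProjectiveDimensionLT_of_globalDimension_eq {d : ℕ} (h : globalDimension A = d)
    (X : ModuleCat.{u} A) : HasProjectiveDimensionLT X (d + 1) :=
  (projectiveDimension_le_iff X d).1
    (h ▸ le_iSup (fun X : ModuleCat.{u} A => projectiveDimension X) X)

end Quotient

/-! ### Syzygies -/

section Syzygy

variable {R : Type u} [Ring R] {𝓡 : ℕ → AddSubgroup R} {M : GrMod 𝓡}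

theorem GradedProjectiveResolution.exists_shortExact (P : GradedProjectiveResolution M) (n : ℕ) :
    ∃ (i : P.syzygy (n + 1) ⟶ ModuleCat.of R (P.P n).carrier)
      (p : ModuleCat.of R (P.P n).carrier ⟶ P.syzygy n) (w : i ≫ p = 0),
      (ShortComplex.mk i p w).ShortExact := by
  obtain ⟨p, hp, hexact⟩ : ∃ p : ModuleCat.of R (P.P n).carrier ⟶ P.syzygy n,
      Function.Surjective p ∧ Function.Exact (P.δ n) p := by
    cases n with
    | zero => exact ⟨ModuleCat.ofHom P.ε, P.surjective_ε, P.exact_zero⟩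
    | succ n =>
      refine ⟨ModuleCat.ofHom (P.δ n).rangeRestrict, (P.δ n).surjective_rangeRestrict,
        fun x => ?_⟩
      rw [← P.exact_succ n x]
      exact Subtype.ext_iff
  let i : P.syzygy (n + 1) ⟶ ModuleCat.of R (P.P n).carrier :=
    ModuleCat.ofHom (LinearMap.range (P.δ n)).subtype
  have hip : Function.Exact i p := fun x => by
    rw [hexact x]
    exact ⟨fun h => ⟨⟨x, h⟩, rfl⟩, fun ⟨y, hy⟩ => hy ▸ y.2⟩
  refine ⟨i, p, ?_, ModuleCat.shortComplex_shortExact _ hip Subtype.val_injective hp⟩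
  ext x
  exact hip.apply_apply_eq_zero x

end Syzygy

/-- The syzygies of a nonzero module are nonzero and their projective dimensions over `A` decrease
to `1`, unless this value has been attained before. -/
theorem exists_pdOver_eq_one_or {k A : Type u} [Field k] [Ring A] [Algebra k A]
    (𝒜 : ℕ → Submodule k A) [GradedAlgebra 𝒜] {d : ℕ} (hd : globalDimension A = d)
    {f : A} {e : ℕ} (hfe : f ∈ 𝒜 e) (hf : IsNormalElement f) (hreg : IsRegular f)
    {M : GrMod (quotientGrading 𝒜 f)} [Nontrivial M.carrier]
    (P : GradedProjectiveResolution M) (n : ℕ) :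
    (∃ i < n, pdOver (P.syzygy i) = 1) ∨ Nontrivial (P.syzygy n) ∧
      HasProjectiveDimensionLT ((ModuleCat.restrictScalars.{u} (proj f)).obj (P.syzygy n))
        (max 2 (d + 1 - n)) := by
  induction n with
  | zero =>
    have := hasProjectiveDimensionLT_of_globalDimension_eq hd
      ((ModuleCat.restrictScalars.{u} (proj f)).obj (P.syzygy 0))
    exact .inr ⟨inferInstanceAs (Nontrivial M.carrier),
      hasProjectiveDimensionLT_of_ge _ (d + 1) _ (by omega)⟩
  | succ n ih =>
    obtain ⟨i, hi, h⟩ | ⟨hnt, hpd⟩ := ih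
    · exact .inl ⟨i, by omega, h⟩
    obtain ⟨i, p, w, hS⟩ := P.exists_shortExact n
    have hS' := restrictScalars_map_shortExact (proj f) hS
    have := (P.isGradedProjective n).projective (quotientProjections 𝒜 hfe hf)
      (mul_mem_quotientGrading 𝒜 f)
    have hP := hasProjectiveDimensionLT_two_of_projective hf hreg (P.P n).carrier
    -- If the next syzygy vanishes, the current one inherits the bound of Pₙ, and being nonzero it
    -- has projective dimension exactly 1.
    rcases subsingleton_or_nontrivial (P.syzygy (n + 1)) with hsub | hnt'
    · have hzero : Limits.IsZero
          ((ModuleCat.restrictScalars.{u} (proj f)).obj (P.syzygy (n + 1))) :=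
        (ModuleCat.restrictScalars.{u} (proj f)).map_isZero
          (ModuleCat.isZero_of_subsingleton _)
      have h0 := (hasProjectiveDimensionLT_zero_iff_isZero _).2 hzero
      have h1 := @hasProjectiveDimensionLT_of_ge _ _ _ _ 0 1 (by omega) h0
      exact .inl ⟨n, n.lt_succ_self, pdOver_eq_one hreg _
        (hS'.hasProjectiveDimensionLT_X₃ 1 h1 hP)⟩
    · refine .inr ⟨hnt', hS'.hasProjectiveDimensionLT_X₁ _
        (@hasProjectiveDimensionLT_of_ge _ _ _ _ 2 _ (by omega) hP)
        (@hasProjectiveDimensionLT_of_ge _ _ _ _ _ _ (by omega) hpd)⟩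

end NCHypersurface

theorem mainTheorem7 {k A : Type u} [Field k] [Ring A] [Algebra k A]
    (𝒜 : ℕ → Submodule k A) [GradedAlgebra 𝒜]
    -- `A` is left noetherian and Artin-Schelter regular of dimension `d`
    [IsNoetherianRing A] (d : ℕ) (hA : NCHypersurface.IsArtinSchelterRegular 𝒜 d)
    -- `f ∈ A₊` is homogeneous, normal and regular
    (f : A) (e : ℕ) (he : 0 < e) (hfe : f ∈ 𝒜 e)
    (hnormal : NCHypersurface.IsNormalElement f) (hregular : IsRegular f)
    -- `M ≠ 0` is a finitely generated graded left module over `B = A / (f)`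
    (M : NCHypersurface.GrMod (NCHypersurface.quotientGrading 𝒜 f))
    (hfg : Module.Finite (NCHypersurface.QuotientBy f) M.carrier)
    (hM : Nontrivial M.carrier)
    (P : NCHypersurface.GradedProjectiveResolution M) :
    ∃ i : ℕ, i ≤ d ∧ NCHypersurface.pdOver (P.syzygy i) = 1 := by
  obtain ⟨i, hi, h⟩ | ⟨hnt, hpd⟩ := NCHypersurface.exists_pdOver_eq_one_or 𝒜
    hA.globalDimension_eq hfe hnormal hregular P d
  · exact ⟨i, hi.le, h⟩
  · rw [max_eq_left (by omega)] at hpd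
    exact ⟨d, le_rfl, NCHypersurface.pdOver_eq_one hregular _ hpd⟩
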